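/- **Theorem.** For $n\ge 0$ let $\mathrm{Av}_n(321)$ be the set of permutations $\sigma=a_1a_2\cdots a_n$ of $\{1,\dots,n\}$ for which there are no indices $i<j<k$ with $a_i>a_j>a_k$. For such $\sigma$ let $\mathrm{inv}\,\sigma$ be the number of pairs $i<j$ with $a_i>a_j$, let $\mathrm{lrm}\,\sigma$ be the number of left-right maxima (entries $a_i$ with $a_i=\max\{a_1,\dots,a_i\}$), and let $\mathrm{fix}\,\sigma$ be the number of fixed points (indices $i$ with $a_i=i$). Define the polynomials $$I_n(q,t,x)=\sum_{\sigma\in \mathrm{Av}_n(321)} q^{\mathrm{inv}\,\sigma}\,t^{\mathrm{lrm}\,\sigma}\,x^{\mathrm{fix}\,\sigma}\qquad(n\ge 0),$$ so that $I_0(q,t,x)=1$. Then for every $n\ge 1$, $$I_n(q,t,x)=tx\,I_{n-1}(q,t,x)+\sum_{k=0}^{n-2} q^{k+1}\,I_k(q,t,1)\,\bigl[I_{n-1-k}(q,t,x)-t(x-1)\,I_{n-2-k}(q,t,x)\bigr],$$ where the sum is empty for $n=1$. -/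

import Mathlib

namespace PatternAvoidance

/-- `σ`, a permutation of `n` letters, contains the pattern `π`, a permutation of `k` letters, when
some subsequence of the word `σ 0, σ 1, …, σ (n - 1)` is order isomorphic to the word of `π`. -/
def Contains {n k : ℕ} (σ : Equiv.Perm (Fin n)) (π : Equiv.Perm (Fin k)) : Prop :=
  ∃ f : Fin k ↪o Fin n, ∀ i j : Fin k, σ (f i) < σ (f j) ↔ π i < π j

/-- The pattern `321`: the decreasing permutation of three letters. -/
def pattern321 : Equiv.Perm (Fin 3) := Fin.revPerm

open Classical in
/-- The set of permutations of `n` letters that avoid the pattern `π`. -/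
noncomputable def Av (n : ℕ) {k : ℕ} (π : Equiv.Perm (Fin k)) : Finset (Equiv.Perm (Fin n)) :=
  Finset.univ.filter fun σ => ¬ Contains σ π

/-- The inversion number: the number of pairs `i < j` with `σ i > σ j`. -/
def numInv {n : ℕ} (σ : Equiv.Perm (Fin n)) : ℕ :=
  (Finset.univ.filter fun p : Fin n × Fin n => p.1 < p.2 ∧ σ p.2 < σ p.1).card

/-- The set of left-right maximum values of `σ`: the values `σ i` with
`σ i = max {σ 0, …, σ i}`. -/
def leftRightMaxima {n : ℕ} (σ : Equiv.Perm (Fin n)) : Finset (Fin n) :=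
  (Finset.univ.filter fun i : Fin n => ∀ j : Fin n, j ≤ i → σ j ≤ σ i).image σ

/-- The number of left-right maxima. -/
def numLrm {n : ℕ} (σ : Equiv.Perm (Fin n)) : ℕ := (leftRightMaxima σ).card

/-- The number of fixed points. -/
def numFix {n : ℕ} (σ : Equiv.Perm (Fin n)) : ℕ :=
  (Finset.univ.filter fun i : Fin n => σ i = i).card

/-- The generating polynomial of the `321`-avoiding permutations of `n` letters by inversions,
left-right maxima and fixed points, evaluated at elements `q`, `t`, `x` of a commutative ring. The
polynomial itself is the case in which these are the variables of a polynomial ring. -/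
noncomputable def genI {R : Type*} [CommRing R] (n : ℕ) (q t x : R) : R :=
  ∑ σ ∈ Av n pattern321, q ^ numInv σ * t ^ numLrm σ * x ^ numFix σ

end PatternAvoidance

/-!
A `321`-avoiding permutation of `n + 1` letters arises exactly once from one of `n` letters by
appending a last entry and shifting up the old entries that are not smaller. Let `a` be the largest
number such that the `a` largest values of `σ` occur in increasing order, and `r` the length of
the longest suffix on which `σ` is the identity. The new last entry can be given exactly
`j = 0, …, a` larger entries to its left. For `j = 0` a left-right maximum is added and the pair
`(a, r)` becomes `(a + 1, r + 1)`. For `j ≥ 1` the entry adds `j` inversions, destroys the last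
`min j r` fixed points, and the pair becomes `(j, 0)`. A fixed point outside the identity suffix
is never destroyed, so it can be counted at once, while those in the suffix stay pending.
Hence `genI n q t x` is the weight of the nodes of depth `n` of the generating tree with these
succession rules (`genI_eq_treeSum`).

The rest is algebra in this tree. Write `T m a r` for the weight `treeSum q t x m a r` below a node
`(a, r)`, and `G` for the case `x = 1`. One pending fixed point more changes `T m a r` by
`(x - 1) * T m r r` (`treeSum_succ_run`), which reduces everything to `r = 0`; and
`T (m + 1) (a + 1) 0 - T (m + 1) a 0 = q ^ (a + 1) * ∑ q ^ i * G i a 0 * T j 1 0`, summed over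
`i + j = m` (`treeSum_succ_label`). At the root, `a = 0`, this is the asserted recurrence, since
`t * T m 1 0 = T (m + 1) 0 0 - t * (x - 1) * T m 0 0`.
-/

namespace PatternAvoidance

/-! ### The weighted generating tree -/

section Algebra

variable {R : Type*} [CommRing R]

/-- The total weight of the descendants, `m` generations down, of a node with label `(a, r)`, where
`r` counts the pending fixed points. A node has a child `(a + 1, r + 1)` of weight `t` and, for each
`1 ≤ j ≤ a`, a child `(j, 0)` of weight `q ^ j`, which turns those `r - j` pending fixed points that
survive (none if `r ≤ j`, by truncated subtraction) into a factor `x ^ (r - j)`. -/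
def treeSum (q t x : R) : ℕ → ℕ → ℕ → R
  | 0, _, r => x ^ r
  | m + 1, a, r => t * treeSum q t x m (a + 1) (r + 1) +
      ∑ j ∈ Finset.range a, q ^ (j + 1) * x ^ (r - (j + 1)) * treeSum q t x m (j + 1) 0

/-- The earliest of `r + 1` pending fixed points survives exactly along the branches that exist
below a node `(r, r)`; the other `r` pending fixed points have the same fate along these branches
as below `(r, r)`. -/
theorem treeSum_succ_run (q t x : R) (m : ℕ) : ∀ a r : ℕ, r < a →
    treeSum q t x m a (r + 1) = treeSum q t x m a r + (x - 1) * treeSum q t x m r r := by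
  induction m with
  | zero => intro a r _; simp only [treeSum]; ring
  | succ m ih =>
    intro a r h
    obtain ⟨b, rfl⟩ := Nat.exists_eq_add_of_lt h
    simp only [treeSum]
    rw [ih _ (r + 1) (by omega)]
    simp only [show r + b + 1 = r + (b + 1) by ring,
      fun f : ℕ → R => Finset.sum_range_add f r (b + 1)]
    have h₁ : ∀ j ∈ Finset.range (b + 1), q ^ (r + j + 1) * x ^ (r + 1 - (r + j + 1)) *
        treeSum q t x m (r + j + 1) 0 = q ^ (r + j + 1) * x ^ (r - (r + j + 1)) *
        treeSum q t x m (r + j + 1) 0 := by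
      intro j _
      rw [show r + 1 - (r + j + 1) = r - (r + j + 1) by omega]
    have h₂ : ∀ j ∈ Finset.range r, q ^ (j + 1) * x ^ (r + 1 - (j + 1)) *
        treeSum q t x m (j + 1) 0 = q ^ (j + 1) * x ^ (r - (j + 1)) *
        treeSum q t x m (j + 1) 0 + (x - 1) * (q ^ (j + 1) * x ^ (r - (j + 1)) *
        treeSum q t x m (j + 1) 0) := by
      intro j hj
      have := Finset.mem_range.1 hj
      rw [show r + 1 - (j + 1) = r - (j + 1) + 1 by omega]
      ring
    rw [Finset.sum_congr rfl h₁, Finset.sum_congr rfl h₂, Finset.sum_add_distrib,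
      ← Finset.mul_sum]
    ring

/-- The succession rule restricted to nodes without pending fixed points. -/
theorem treeSum_succ_zero (q t x : R) (m a : ℕ) :
    treeSum q t x (m + 1) a 0 = t * treeSum q t x m (a + 1) 0 +
      t * (x - 1) * treeSum q t x m 0 0 +
      ∑ j ∈ Finset.range a, q ^ (j + 1) * treeSum q t x m (j + 1) 0 := by
  simp only [treeSum, zero_add, Nat.zero_sub, pow_zero, mul_one]
  rw [treeSum_succ_run q t x m (a + 1) 0 (by omega)]
  ring

/-- The effect of raising the label by one factors as a convolution of the tree without fixed-point
weight, in which each step costs an additional factor `q`, with the tree below the label `1`. -/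
theorem treeSum_succ_label (q t x : R) (m : ℕ) : ∀ a : ℕ,
    treeSum q t x (m + 1) (a + 1) 0 = treeSum q t x (m + 1) a 0 +
      q ^ (a + 1) * ∑ p ∈ Finset.HasAntidiagonal.antidiagonal m,
        q ^ p.1 * treeSum q t 1 p.1 a 0 * treeSum q t x p.2 1 0 := by
  induction m with
  | zero =>
    intro a
    simp [treeSum, Finset.sum_range_succ]
    ring
  | succ m ih =>
    intro a
    -- The increments at the level below telescope, as the labels of the first step do.
    have htel : ∀ b : ℕ, treeSum q t x (m + 1) (b + 1) 0 = treeSum q t x (m + 1) 1 0 +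
        ∑ l ∈ Finset.range b, q ^ (l + 2) * ∑ p ∈ Finset.HasAntidiagonal.antidiagonal m,
          q ^ p.1 * treeSum q t 1 p.1 (l + 1) 0 * treeSum q t x p.2 1 0 := by
      intro b
      induction b with
      | zero => simp
      | succ b ihb => rw [ih, ihb, Finset.sum_range_succ]; ring
    have hconv : ∑ p ∈ Finset.HasAntidiagonal.antidiagonal (m + 1),
        q ^ p.1 * treeSum q t 1 p.1 a 0 * treeSum q t x p.2 1 0 =
        t * q * (∑ p ∈ Finset.HasAntidiagonal.antidiagonal m,
          q ^ p.1 * treeSum q t 1 p.1 (a + 1) 0 * treeSum q t x p.2 1 0) +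
        treeSum q t x (m + 1) (a + 1) 0 := by
      rw [htel a, Finset.Nat.sum_antidiagonal_succ]
      simp only [treeSum_succ_zero q t 1, sub_self, mul_zero, zero_mul, add_zero]
      simp only [Finset.mul_sum]
      rw [Finset.sum_comm, add_left_comm, ← Finset.sum_add_distrib]
      congr 1
      · simp [treeSum]
      · refine Finset.sum_congr rfl fun p _ => ?_
        rw [mul_add, add_mul, Finset.mul_sum, Finset.sum_mul]
        congr 1
        · ring
        · exact Finset.sum_congr rfl fun l _ => by ring
    rw [hconv, treeSum_succ_zero q t x (m + 1) (a + 1), treeSum_succ_zero q t x (m + 1) a,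
      ih (a + 1), Finset.sum_range_succ]
    ring

theorem treeSum_recurrence (q t x : R) (n : ℕ) :
    treeSum q t x (n + 1) 0 0 = t * x * treeSum q t x n 0 0 +
      ∑ k ∈ Finset.range n, q ^ (k + 1) * treeSum q t 1 k 0 0 *
        (treeSum q t x (n - k) 0 0 - t * (x - 1) * treeSum q t x (n - 1 - k) 0 0) := by
  -- The bracket in the recurrence is what remains of the first step from the root.
  have h0 : ∀ m, treeSum q t x (m + 1) 0 0 - t * (x - 1) * treeSum q t x m 0 0 =
      t * treeSum q t x m 1 0 := by
    intro m
    rw [treeSum_succ_zero]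
    simp
  rw [sub_eq_iff_eq_add.1 (h0 n)]
  cases n with
  | zero => simp [treeSum]; ring
  | succ n =>
    rw [treeSum_succ_label, Finset.Nat.sum_antidiagonal_eq_sum_range_succ
      (fun i j => q ^ i * treeSum q t 1 i 0 0 * treeSum q t x j 1 0)]
    have : ∀ k ∈ Finset.range (n + 1), q ^ (k + 1) * treeSum q t 1 k 0 0 *
        (treeSum q t x (n + 1 - k) 0 0 - t * (x - 1) * treeSum q t x (n + 1 - 1 - k) 0 0) =
        t * q * (q ^ k * treeSum q t 1 k 0 0 * treeSum q t x (n - k) 1 0) := by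
      intro k hk
      have := Finset.mem_range.1 hk
      rw [show n + 1 - k = n - k + 1 by omega, show n + 1 - 1 - k = n - k by omega, h0]
      ring
    rw [Finset.sum_congr rfl this, ← Finset.mul_sum]
    simp only [Nat.succ_eq_add_one]
    ring

end Algebra
/-! ### Appending a last entry -/

section Tree

variable {n : ℕ}

theorem mem_Av_pattern321 {σ : Equiv.Perm (Fin n)} :
    σ ∈ Av n pattern321 ↔ ∀ i j k : Fin n, i < j → j < k → σ j < σ i → ¬ σ k < σ j := by
  simp only [Av, Finset.mem_filter, Finset.mem_univ, true_and]
  simp only [Contains, pattern321]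
  constructor
  · intro h i j k hij hjk h₁ h₂
    refine h ⟨OrderEmbedding.ofStrictMono ![i, j, k] ?_, ?_⟩
    · rw [Fin.strictMono_iff_lt_succ]
      intro a
      fin_cases a
      · exact hij
      · exact hjk
    · intro a b
      rw [Fin.revPerm_apply, Fin.revPerm_apply, Fin.rev_lt_rev]
      have h₃ := h₂.trans h₁
      fin_cases a <;> fin_cases b <;> simp [h₁, h₂, h₃, h₁.le, h₂.le, h₃.le]
  · rintro h ⟨f, hf⟩
    refine h (f 0) (f 1) (f 2) (f.lt_iff_lt.2 (by decide)) (f.lt_iff_lt.2 (by decide))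
      ((hf _ _).2 (by decide)) ((hf _ _).2 (by decide))

/-- The permutation of `n + 1` letters with last entry `v` whose other entries are in the same
relative order as those of `σ`: values of `σ` at least `v` are raised by one. -/
def insertLast (v : Fin (n + 1)) (σ : Equiv.Perm (Fin n)) : Equiv.Perm (Fin (n + 1)) :=
  (finSuccEquivLast.trans (Equiv.optionCongr σ)).trans (finSuccEquiv' v).symm

@[simp]
theorem insertLast_last (v : Fin (n + 1)) (σ : Equiv.Perm (Fin n)) :
    insertLast v σ (Fin.last n) = v := by
  simp [insertLast]

@[simp]
theorem insertLast_castSucc (v : Fin (n + 1)) (σ : Equiv.Perm (Fin n)) (i : Fin n) :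
    insertLast v σ i.castSucc = v.succAbove (σ i) := by
  simp [insertLast]

theorem insertLast_bijective : Function.Bijective
    fun p : Fin (n + 1) × Equiv.Perm (Fin n) => insertLast p.1 p.2 := by
  rw [Fintype.bijective_iff_injective_and_card]
  constructor
  · rintro ⟨v, σ⟩ ⟨w, τ⟩ h
    have hv : v = w := by simpa using DFunLike.congr_fun h (Fin.last n)
    subst hv
    have : σ = τ := by
      ext1 i
      exact Fin.succAbove_right_injective (p := v)
        (by simpa using DFunLike.congr_fun h i.castSucc)
    rw [this]
  · simp [Fintype.card_perm, Nat.factorial_succ]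

theorem lt_succAbove_iff_val {v : Fin (n + 1)} {a : Fin n} :
    v < v.succAbove a ↔ (v : ℕ) ≤ a := by
  rw [Fin.lt_succAbove_iff_le_castSucc]; rfl

theorem numInv_insertLast (v : Fin (n + 1)) (σ : Equiv.Perm (Fin n)) :
    numInv (insertLast v σ) = numInv σ + (n - v) := by
  have hcard : (Finset.univ.filter fun i : Fin n => (v : ℕ) ≤ σ i).card = n - v := by
    rw [← Finset.card_map σ.toEmbedding]
    have : (Finset.univ.filter fun i : Fin n => (v : ℕ) ≤ σ i).map σ.toEmbedding =
        Finset.univ.filter fun a : Fin n => ¬ (a : ℕ) < v := by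
      ext a
      simp only [Finset.mem_map_equiv, Finset.mem_filter, Finset.mem_univ, true_and,
        Equiv.apply_symm_apply, not_lt]
    rw [this, Finset.filter_not, Finset.card_sdiff_of_subset (Finset.filter_subset _ _),
      Fin.card_filter_val_lt]
    have := v.is_le
    simp [this]
  simp only [numInv, Finset.card_filter, ← Finset.univ_product_univ, Finset.sum_product,
    Fin.sum_univ_castSucc]
  simp only [insertLast_castSucc, insertLast_last, Fin.castSucc_lt_castSucc_iff,
    Fin.castSucc_lt_last, true_and, lt_succAbove_iff_val,
    (Fin.strictMono_succAbove v).lt_iff_lt, lt_irrefl, false_and, if_false, add_zero,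
    not_lt_of_gt (Fin.castSucc_lt_last _), Finset.sum_const_zero, Finset.sum_add_distrib]
  rw [← hcard, Finset.card_filter]

theorem numLrm_eq (σ : Equiv.Perm (Fin n)) :
    numLrm σ = (Finset.univ.filter fun i : Fin n => ∀ j : Fin n, j ≤ i → σ j ≤ σ i).card :=
  Finset.card_image_of_injective _ σ.injective

theorem numLrm_insertLast (v : Fin (n + 1)) (σ : Equiv.Perm (Fin n)) :
    numLrm (insertLast v σ) = numLrm σ + if v = Fin.last n then 1 else 0 := by
  simp only [numLrm_eq, Finset.card_filter, Fin.sum_univ_castSucc]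
  have h₁ : ∀ i : Fin n, (∀ j : Fin (n + 1), j ≤ i.castSucc →
      insertLast v σ j ≤ insertLast v σ i.castSucc) ↔ ∀ j : Fin n, j ≤ i → σ j ≤ σ i := by
    intro i
    rw [Fin.forall_fin_succ']
    simp [(Fin.strictMono_succAbove v).le_iff_le]
  have h₂ : (∀ j : Fin (n + 1), j ≤ Fin.last n →
      insertLast v σ j ≤ insertLast v σ (Fin.last n)) ↔ v = Fin.last n := by
    constructor
    · intro h
      have := h ((insertLast v σ).symm (Fin.last n)) (Fin.le_last _)
      rw [Equiv.apply_symm_apply, insertLast_last] at this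
      exact Fin.last_le_iff.1 this
    · rintro rfl j _
      rw [insertLast_last]
      exact Fin.le_last _
  simp only [h₁, h₂]

/-! ### The label of a permutation -/

/-- The values `≥ v` of `σ` occur in increasing order. The condition on `σ i` follows from that on
`σ j`, as only `σ j < σ i` is excluded. -/
def IncreasingAbove (σ : Equiv.Perm (Fin n)) (v : ℕ) : Prop :=
  ∀ i j : Fin n, i < j → v ≤ σ j → ¬ σ j < σ i

/-- Every position `≥ s` is a fixed point of `σ`. -/
def FixedFrom (σ : Equiv.Perm (Fin n)) (s : ℕ) : Prop :=
  ∀ i : Fin n, s ≤ i → σ i = i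

/-- The least `v` for which the values `≥ v` of `σ` occur in increasing order; the first component of
the label of `σ` is `n - topStart σ`. -/
noncomputable def topStart (σ : Equiv.Perm (Fin n)) : ℕ := sInf {v | IncreasingAbove σ v}

/-- The least `s` for which `σ` fixes every position `≥ s`; the second component of the label of `σ`
is `n - tailStart σ`. -/
noncomputable def tailStart (σ : Equiv.Perm (Fin n)) : ℕ := sInf {s | FixedFrom σ s}

theorem increasingAbove_size (σ : Equiv.Perm (Fin n)) : IncreasingAbove σ n :=
  fun _ j _ h => absurd h (by have := (σ j).is_lt; omega)

theorem fixedFrom_size (σ : Equiv.Perm (Fin n)) : FixedFrom σ n :=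
  fun i h => absurd h (by have := i.is_lt; omega)

theorem topStart_le_iff {σ : Equiv.Perm (Fin n)} {v : ℕ} :
    topStart σ ≤ v ↔ IncreasingAbove σ v := by
  refine ⟨fun h i j hij hj => ?_, fun h => Nat.sInf_le h⟩
  have : IncreasingAbove σ (topStart σ) :=
    Nat.sInf_mem (s := {v | IncreasingAbove σ v}) ⟨n, increasingAbove_size σ⟩
  exact this i j hij (h.trans hj)

theorem tailStart_le_iff {σ : Equiv.Perm (Fin n)} {s : ℕ} :
    tailStart σ ≤ s ↔ FixedFrom σ s := by
  refine ⟨fun h i hi => ?_, fun h => Nat.sInf_le h⟩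
  have : FixedFrom σ (tailStart σ) :=
    Nat.sInf_mem (s := {s | FixedFrom σ s}) ⟨n, fixedFrom_size σ⟩
  exact this i (h.trans hi)

theorem insertLast_mem_Av {v : Fin (n + 1)} {σ : Equiv.Perm (Fin n)} :
    insertLast v σ ∈ Av (n + 1) pattern321 ↔ σ ∈ Av n pattern321 ∧ topStart σ ≤ v := by
  rw [mem_Av_pattern321, mem_Av_pattern321, topStart_le_iff]
  simp only [Fin.forall_fin_succ', insertLast_castSucc, insertLast_last,
    Fin.castSucc_lt_castSucc_iff, (Fin.strictMono_succAbove v).lt_iff_lt,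
    Fin.castSucc_lt_last, lt_succAbove_iff_val, not_lt_of_gt (Fin.castSucc_lt_last _),
    lt_irrefl, IncreasingAbove]
  constructor
  · intro h
    exact ⟨fun i j k => ((h.1 i).1 j).1 k, fun i j hij hv hlt => ((h.1 i).1 j).2 hij trivial hlt hv⟩
  · rintro ⟨h₁, h₂⟩
    refine ⟨fun i => ⟨fun j => ⟨h₁ i j, fun hij _ hlt hv => h₂ i j hij hv hlt⟩, ?_⟩, ?_⟩ <;> simp

theorem topStart_le_size (σ : Equiv.Perm (Fin n)) : topStart σ ≤ n :=
  topStart_le_iff.2 (increasingAbove_size σ)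

theorem tailStart_le_size (σ : Equiv.Perm (Fin n)) : tailStart σ ≤ n :=
  tailStart_le_iff.2 (fixedFrom_size σ)

theorem topStart_insertLast_last (σ : Equiv.Perm (Fin n)) :
    topStart (insertLast (Fin.last n) σ) = topStart σ := by
  refine eq_of_forall_ge_iff fun w => ?_
  rw [topStart_le_iff, topStart_le_iff]
  simp [IncreasingAbove, Fin.forall_fin_succ', not_lt_of_gt (Fin.castSucc_lt_last _), Fin.le_last]

theorem topStart_insertLast_castSucc {v : Fin n} {σ : Equiv.Perm (Fin n)}
    (hv : topStart σ ≤ v) : topStart (insertLast v.castSucc σ) = v + 1 := by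
  refine eq_of_forall_ge_iff fun w => ?_
  rw [topStart_le_iff] at hv ⊢
  constructor
  · intro h
    by_contra! hw
    refine h (σ.symm v).castSucc (Fin.last n) (Fin.castSucc_lt_last _) ?_ ?_
    · rw [insertLast_last]; exact Nat.lt_succ_iff.1 hw
    · rw [insertLast_last, insertLast_castSucc, lt_succAbove_iff_val]; simp
  · intro hw i j
    refine Fin.lastCases ?_ (fun j => ?_) j
    · intro _ h
      rw [insertLast_last] at h
      exact absurd h (by simpa using hw)
    · refine Fin.lastCases (fun h => absurd h (not_lt_of_gt (Fin.castSucc_lt_last _)))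
        (fun i => ?_) i
      simp only [insertLast_castSucc, Fin.castSucc_lt_castSucc_iff,
        (Fin.strictMono_succAbove v.castSucc).lt_iff_lt]
      intro hij hj
      refine hv i j hij ?_
      rw [← Fin.val_castSucc v, ← lt_succAbove_iff_val, Fin.lt_def, Fin.val_castSucc]
      omega

theorem tailStart_insertLast_last (σ : Equiv.Perm (Fin n)) :
    tailStart (insertLast (Fin.last n) σ) = tailStart σ := by
  refine eq_of_forall_ge_iff fun w => ?_
  rw [tailStart_le_iff, tailStart_le_iff]
  simp [FixedFrom, Fin.forall_fin_succ']

theorem tailStart_insertLast_castSucc (v : Fin n) (σ : Equiv.Perm (Fin n)) :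
    tailStart (insertLast v.castSucc σ) = n + 1 := by
  refine le_antisymm (tailStart_le_size _) ?_
  by_contra! h
  have := tailStart_le_iff.1 (Nat.lt_succ_iff.1 h) (Fin.last n) le_rfl
  rw [insertLast_last] at this
  exact (Fin.castSucc_lt_last v).ne this

/-! ### Fixed points -/

theorem lt_apply_of_forall_lt {σ : Equiv.Perm (Fin n)} {i : Fin n} (hi : σ i = i)
    (h : ∀ j < i, σ j < i) {k : Fin n} (hk : i < k) : i < σ k := by
  have himage : (Finset.Iio i).image σ = Finset.Iio i := by
    refine Finset.eq_of_subset_of_card_le (fun a ha => ?_)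
      (Finset.card_image_of_injective _ σ.injective).ge
    obtain ⟨j, hj, rfl⟩ := Finset.mem_image.1 ha
    exact Finset.mem_Iio.2 (h j (Finset.mem_Iio.1 hj))
  by_contra! hle
  rcases hle.lt_or_eq with hlt | heq
  · rw [← Finset.mem_Iio, ← himage] at hlt
    obtain ⟨j, hj, hjk⟩ := Finset.mem_image.1 hlt
    rw [σ.injective hjk] at hj
    exact lt_asymm hk (Finset.mem_Iio.1 hj)
  · exact hk.ne' (σ.injective (heq.trans hi.symm))

/-- No entry after a fixed point `i` of a `321`-avoiding permutation is smaller: it would force, by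
counting, a larger entry before `i`, and the three entries would form the pattern. -/
theorem lt_apply_of_mem_Av {σ : Equiv.Perm (Fin n)} (hσ : σ ∈ Av n pattern321) {i : Fin n}
    (hi : σ i = i) {k : Fin n} (hk : i < k) : i < σ k := by
  by_contra! hle
  have hki : σ k < i := hle.lt_of_ne fun h => hk.ne' (σ.injective (h.trans hi.symm))
  refine hle.not_gt (lt_apply_of_forall_lt hi (fun j hj => ?_) hk)
  by_contra! hij
  refine mem_Av_pattern321.1 hσ j i k hj hk ?_ (hi.symm ▸ hki)
  rw [hi]
  exact hij.lt_of_ne fun h => hj.ne (σ.injective (h.symm.trans hi.symm))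

/-- If the values from a fixed point `i` on occur in increasing order, then `σ` is the identity from
`i` on. -/
theorem IncreasingAbove.fixedFrom {σ : Equiv.Perm (Fin n)} {i : Fin n} (hi : σ i = i)
    (h : IncreasingAbove σ i) : FixedFrom σ i := by
  have hlow : ∀ j < i, σ j < i := by
    intro j hj
    have := not_lt.1 (h j i hj (by rw [hi]))
    rw [hi] at this
    exact this.lt_of_ne fun h => hj.ne (σ.injective (h.trans hi.symm))
  intro k
  induction k using WellFoundedLT.induction with
  | ind k ih =>
  intro hik
  rcases (show i ≤ k from hik).eq_or_lt with rfl | hik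
  · exact hi
  rcases lt_trichotomy (σ k) k with hlt | heq | hgt
  · exact absurd (σ.injective (ih _ hlt (lt_apply_of_forall_lt hi hlow hik).le)) hlt.ne
  · exact heq
  · obtain ⟨l, rfl⟩ := σ.surjective k
    rcases lt_trichotomy l (σ l) with hl | hl | hl
    · rcases lt_or_ge l i with hli | hli
      · exact absurd (hlow l hli) hik.not_gt
      · exact absurd (ih l hl hli) hl.ne'
    · rw [← hl] at hgt
      exact absurd hl hgt.ne
    · exact absurd hgt (h _ _ hl hik.le)

/-- The number of fixed points outside the identity suffix of `σ`. No fixed point counted here is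
lost when further entries are appended to a `321`-avoiding permutation. -/
noncomputable def earlyFix (σ : Equiv.Perm (Fin n)) : ℕ :=
  (Finset.univ.filter fun i : Fin n => σ i = i ∧ (i : ℕ) < tailStart σ).card

theorem card_fixed_lt_of_tailStart_le {σ : Equiv.Perm (Fin n)} {v : ℕ} (hv : v ≤ n)
    (h : tailStart σ ≤ v) :
    (Finset.univ.filter fun i : Fin n => σ i = i ∧ (i : ℕ) < v).card =
      earlyFix σ + (v - tailStart σ) := by
  have hfix := tailStart_le_iff.1 (le_refl (tailStart σ))
  have hcard := Finset.card_filter_add_card_filter_not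
    (s := Finset.univ.filter fun i : Fin n => (i : ℕ) < v) fun i => (i : ℕ) < tailStart σ
  rw [← Finset.card_filter_add_card_filter_not fun i : Fin n => (i : ℕ) < tailStart σ]
  simp only [Finset.filter_filter] at hcard ⊢
  have h₁ : ∀ i : Fin n, ((i : ℕ) < v ∧ (i : ℕ) < tailStart σ) ↔ (i : ℕ) < tailStart σ :=
    fun i => ⟨fun h => h.2, fun h' => ⟨h'.trans_le h, h'⟩⟩
  have h₂ : ∀ i : Fin n, ((σ i = i ∧ (i : ℕ) < v) ∧ (i : ℕ) < tailStart σ) ↔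
      σ i = i ∧ (i : ℕ) < tailStart σ :=
    fun i => ⟨fun h => ⟨h.1.1, h.2⟩, fun h' => ⟨⟨h'.1, h'.2.trans_le h⟩, h'.2⟩⟩
  have h₃ : ∀ i : Fin n, ((σ i = i ∧ (i : ℕ) < v) ∧ ¬ (i : ℕ) < tailStart σ) ↔
      (i : ℕ) < v ∧ ¬ (i : ℕ) < tailStart σ :=
    fun i => ⟨fun h => ⟨h.1.2, h.2⟩, fun h' => ⟨⟨hfix i (not_lt.1 h'.2), h'.1⟩, h'.2⟩⟩
  simp only [h₁, Fin.card_filter_val_lt, min_eq_right hv, min_eq_right (h.trans hv)] at hcard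
  simp only [h₂, h₃, earlyFix]
  omega

/-- No fixed point lies between an admissible new entry `v` and a later beginning of the identity
suffix, so the fixed points below `v` are the early ones and the part of the suffix below `v`. -/
theorem card_fixed_lt {σ : Equiv.Perm (Fin n)} {v : ℕ} (hv : v ≤ n) (h : topStart σ ≤ v) :
    (Finset.univ.filter fun i : Fin n => σ i = i ∧ (i : ℕ) < v).card =
      earlyFix σ + (v - tailStart σ) := by
  rcases le_or_gt (tailStart σ) v with hs | hs
  · exact card_fixed_lt_of_tailStart_le hv hs
  rw [Nat.sub_eq_zero_of_le hs.le, add_zero, earlyFix]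
  congr 1
  refine Finset.filter_congr fun i _ =>
    and_congr_right fun hi => ⟨fun h => h.trans hs, fun his => ?_⟩
  by_contra! hvi
  exact his.not_ge
    (tailStart_le_iff.2 (IncreasingAbove.fixedFrom hi (topStart_le_iff.1 (h.trans hvi))))

theorem numFix_eq (σ : Equiv.Perm (Fin n)) : numFix σ = earlyFix σ + (n - tailStart σ) := by
  rw [← card_fixed_lt_of_tailStart_le le_rfl (tailStart_le_size σ)]
  simp [numFix]

theorem earlyFix_insertLast_last (σ : Equiv.Perm (Fin n)) :
    earlyFix (insertLast (Fin.last n) σ) = earlyFix σ := by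
  have := tailStart_le_size σ
  simp only [earlyFix, tailStart_insertLast_last, Finset.card_filter, Fin.sum_univ_castSucc]
  simp [this]

/-- After an entry `v` that is not the maximum is appended, the identity suffix is empty, and the
fixed points are those of `σ` below `v`, because the last entry cannot be smaller than a fixed
point. -/
theorem earlyFix_insertLast_castSucc {v : Fin n} {σ : Equiv.Perm (Fin n)}
    (hσ : σ ∈ Av n pattern321) (hv : topStart σ ≤ v) :
    earlyFix (insertLast v.castSucc σ) = earlyFix σ + (v - tailStart σ) := by
  have hτ : insertLast v.castSucc σ ∈ Av (n + 1) pattern321 := insertLast_mem_Av.2 ⟨hσ, hv⟩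
  rw [← card_fixed_lt v.is_lt.le hv, earlyFix, tailStart_insertLast_castSucc]
  simp only [Finset.card_filter, Fin.sum_univ_castSucc, insertLast_last, Fin.is_lt, and_true]
  rw [if_neg (Fin.castSucc_lt_last v).ne, add_zero]
  refine Finset.sum_congr rfl fun i _ => if_congr ?_ rfl rfl
  constructor
  · intro hi
    have hlt : i.castSucc < v.castSucc := by
      have := lt_apply_of_mem_Av hτ hi (Fin.castSucc_lt_last i)
      rwa [insertLast_last] at this
    rw [insertLast_castSucc] at hi
    refine ⟨?_, hlt⟩
    have := (Fin.succAbove_lt_iff_castSucc_lt v.castSucc (σ i)).1 (hi ▸ hlt)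
    rw [Fin.succAbove_of_castSucc_lt _ _ this] at hi
    exact Fin.castSucc_injective _ hi
  · rintro ⟨hi, hlt⟩
    rw [insertLast_castSucc, hi]
    exact Fin.succAbove_of_castSucc_lt _ _ hlt

end Tree

/-! ### Summation over the tree -/

section Sum

variable {R : Type*} [CommRing R]

/-- The weight of `σ`, without its pending fixed points, times the weight of the `m`-th generation of
the tree below the label of `σ`. -/
noncomputable def descendantSum (q t x : R) (m : ℕ) {n : ℕ} (σ : Equiv.Perm (Fin n)) : R :=
  q ^ numInv σ * t ^ numLrm σ * x ^ earlyFix σ *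
    treeSum q t x m (n - topStart σ) (n - tailStart σ)

theorem descendantSum_insertLast_last (q t x : R) (m : ℕ) {n : ℕ} (σ : Equiv.Perm (Fin n)) :
    descendantSum q t x m (insertLast (Fin.last n) σ) =
      q ^ numInv σ * t ^ numLrm σ * x ^ earlyFix σ *
        (t * treeSum q t x m (n - topStart σ + 1) (n - tailStart σ + 1)) := by
  rw [descendantSum, numInv_insertLast, numLrm_insertLast, if_pos rfl, earlyFix_insertLast_last,
    topStart_insertLast_last, tailStart_insertLast_last, Fin.val_last, Nat.sub_self, add_zero,
    Nat.sub_add_comm (topStart_le_size σ), Nat.sub_add_comm (tailStart_le_size σ)]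
  ring

theorem descendantSum_insertLast_castSucc (q t x : R) (m : ℕ) {n : ℕ} {v : Fin n}
    {σ : Equiv.Perm (Fin n)} (hσ : σ ∈ Av n pattern321) (hv : topStart σ ≤ v) :
    descendantSum q t x m (insertLast v.castSucc σ) =
      q ^ numInv σ * t ^ numLrm σ * x ^ earlyFix σ *
        (q ^ (n - v) * x ^ (v - tailStart σ) * treeSum q t x m (n - v) 0) := by
  rw [descendantSum, numInv_insertLast, numLrm_insertLast, if_neg (Fin.castSucc_lt_last v).ne,
    earlyFix_insertLast_castSucc hσ hv, topStart_insertLast_castSucc hv,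
    tailStart_insertLast_castSucc, Fin.val_castSucc, Nat.sub_self, Nat.add_sub_add_right]
  ring

theorem sum_descendantSum_insertLast (q t x : R) (m : ℕ) {n : ℕ} {σ : Equiv.Perm (Fin n)}
    (hσ : σ ∈ Av n pattern321) :
    (∑ v : Fin (n + 1), if topStart σ ≤ v then descendantSum q t x m (insertLast v σ) else 0) =
      descendantSum q t x (m + 1) σ := by
  have hn := topStart_le_size σ
  rw [Fin.sum_univ_castSucc, Fin.val_last, if_pos hn, descendantSum_insertLast_last,
    descendantSum, treeSum, mul_add, add_comm]
  congr 1
  -- The entry `v` has `j + 1` larger entries to its left when `v = n - 1 - j`.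
  rw [← Equiv.sum_comp Fin.revPerm, Finset.mul_sum]
  have hterm : ∀ j : Fin n,
      (if topStart σ ≤ ((Fin.revPerm j).castSucc : Fin (n + 1)) then
        descendantSum q t x m (insertLast (Fin.revPerm j).castSucc σ) else 0) =
      if (j : ℕ) < n - topStart σ then q ^ numInv σ * t ^ numLrm σ * x ^ earlyFix σ *
        (q ^ ((j : ℕ) + 1) * x ^ (n - tailStart σ - (j + 1)) * treeSum q t x m (j + 1) 0)
      else 0 := by
    intro j
    have hj := j.is_lt
    have hrev : ((Fin.revPerm j : Fin n) : ℕ) = n - (j + 1) := by simp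
    refine ite_congr (by rw [Fin.val_castSucc, hrev, eq_iff_iff]; omega) (fun h => ?_) fun _ => rfl
    rw [descendantSum_insertLast_castSucc q t x m hσ (by rw [hrev]; omega), hrev,
      show n - (n - ((j : ℕ) + 1)) = j + 1 by omega, Nat.sub_right_comm]
  rw [Finset.sum_congr rfl fun j _ => hterm j, Fin.sum_univ_eq_sum_range (fun j =>
      if j < n - topStart σ then q ^ numInv σ * t ^ numLrm σ * x ^ earlyFix σ *
        (q ^ (j + 1) * x ^ (n - tailStart σ - (j + 1)) * treeSum q t x m (j + 1) 0)
      else 0) n, ← Finset.sum_filter]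
  refine Finset.sum_congr (Finset.ext fun j => ?_) fun _ _ => rfl
  rw [Finset.mem_filter, Finset.mem_range, Finset.mem_range]
  omega

theorem sum_descendantSum_succ (q t x : R) (m n : ℕ) :
    ∑ τ ∈ Av (n + 1) pattern321, descendantSum q t x m τ =
      ∑ σ ∈ Av n pattern321, descendantSum q t x (m + 1) σ := by
  classical
  rw [← Finset.univ_inter (Av (n + 1) pattern321), ← Finset.sum_ite_mem,
    ← (insertLast_bijective (n := n)).sum_comp, Fintype.sum_prod_type_right,
    ← Finset.univ_inter (Av n pattern321), ← Finset.sum_ite_mem]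
  refine Finset.sum_congr rfl fun σ _ => ?_
  simp only [insertLast_mem_Av]
  by_cases hσ : σ ∈ Av n pattern321
  · simp only [hσ, true_and, if_true]
    exact sum_descendantSum_insertLast q t x m hσ
  · simp [hσ]

theorem sum_descendantSum (q t x : R) (n : ℕ) : ∀ m : ℕ,
    ∑ σ ∈ Av n pattern321, descendantSum q t x m σ = treeSum q t x (n + m) 0 0 := by
  induction n with
  | zero =>
    intro m
    have hAv : Av 0 pattern321 = {1} := by
      ext σ
      simp [mem_Av_pattern321, Subsingleton.elim σ 1]
    simp [hAv, descendantSum, numInv, numLrm_eq, earlyFix]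
  | succ n ih =>
    intro m
    rw [sum_descendantSum_succ, ih, Nat.succ_add_eq_add_succ]

theorem genI_eq_treeSum (n : ℕ) (q t x : R) : genI n q t x = treeSum q t x n 0 0 := by
  rw [← add_zero n, ← sum_descendantSum, add_zero, genI]
  refine Finset.sum_congr rfl fun σ _ => ?_
  rw [descendantSum, treeSum, numFix_eq, pow_add, mul_assoc _ (x ^ _) (x ^ _)]

end Sum

end PatternAvoidance

theorem mainTheorem4 {R : Type*} [CommRing R] (q t x : R) (n : ℕ) (hn : 1 ≤ n) :
    PatternAvoidance.genI n q t x =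
      t * x * PatternAvoidance.genI (n - 1) q t x +
        ∑ k ∈ Finset.range (n - 1),
          q ^ (k + 1) * PatternAvoidance.genI k q t 1 *
            (PatternAvoidance.genI (n - 1 - k) q t x -
              t * (x - 1) * PatternAvoidance.genI (n - 2 - k) q t x) := by
  obtain ⟨n, rfl⟩ := Nat.exists_eq_add_of_le' hn
  simp only [PatternAvoidance.genI_eq_treeSum]
  exact PatternAvoidance.treeSum_recurrence q t x n
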